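/- Let $\varepsilon>0$ and write $\operatorname{erfi}(x)=\int_0^x e^{w^2}\,dw$. Consider the following online learner on $[0,\infty)$ (the discounted 1D magnitude learner). Initialize $v_1=s_1=h_1=0$. In round $t=1,2,\ldots$, set $\tilde x_t=0$ if $h_t=0$, and otherwise, with $W_t=v_t+2h_ts_t+16h_t^2$, $$\tilde x_t=\varepsilon\operatorname{erfi}\!\Big(\frac{s_t}{2\sqrt{W_t}}\Big)-\frac{\varepsilon h_t}{\sqrt{W_t}}\exp\!\Big(\frac{s_t^2}{4W_t}\Big).$$ The learner predicts $x_t=\max(\tilde x_t,0)$; a convex loss $l_t:[0,\infty)\to\mathbb R$ is chosen, and the learner receives a subgradient $g_t\in\partial l_t(x_t)$ and a discount factor $\lambda_{t-1}\in(0,\infty)$. Let $\bar g_t$ be the projection of $g_t$ onto $[-\lambda_{t-1}h_t,\lambda_{t-1}h_t]$, and let $\tilde g_t=0$ if $\bar g_t\tilde x_t<\bar g_tx_t$ and $\tilde g_t=\bar g_t$ otherwise. Update $$h_{t+1}=\max(\lambda_{t-1}h_t,|g_t|),\qquad v_{t+1}=\lambda_{t-1}^2v_t+\tilde g_t^2,\qquad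 s_{t+1}=\lambda_{t-1}s_t-\tilde g_t .$$ Define $V_t=\sum_{i=1}^t\big(\prod_{j=i}^{t-1}\lambda_j^2\big)g_i^2$ and $G_t=\max_{1\le i\le t}\big(\prod_{j=i}^{t-1}\lambda_j\big)|g_i|$. Then for every $T\ge1$, all convex losses $l_1,\ldots,l_T$, all subgradients $g_t\in\partial l_t(x_t)$ and discount factors $\lambda_0,\ldots,\lambda_{T-1}\in(0,\infty)$ as above, every comparator $u\in[0,\infty)$ and every window length $\tau\in\{1,\ldots,T\}$, $$\sum_{t=1}^T\Big(\prod_{i=t}^{T-1}\lambda_i\Big)\big[l_t(x_t)-l_t(u)\big]\le \varepsilon\sqrt{V_T+2G_TS+16G_T^2}+u(S+G_T)+\Big(\max_{T-\tau+1\le t\le T}x_t\Big)G_T+\Big(\prod_{t=T-\tau}^{T-1}\lambda_t\Big)\Big(\max_{1\le t\le T-\tau}x_t\Big)G_{T-\tau},$$ where $$S=8G_T\Big(1+\sqrt{\log(2u\varepsilon^{-1}+1)}\Big)^2+2\sqrt{V_T+16G_T^2}\,\Big(1+\sqrt{\log(2u\varepsilon^{-1}+1)}\Big).$$ Empty products are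 $1$; for $\tau=T$ the last term, whose maxima are over empty sets, is $0$. -/

import Mathlib

namespace MagnitudeLearner

noncomputable section

/-- The (rescaled) imaginary error function `erfi x = ∫₀ˣ exp (u²) du`. -/
def erfi (x : ℝ) : ℝ := ∫ u in (0 : ℝ)..x, Real.exp (u ^ 2)

/-- The maximum of the finitely many values `f a, …, f b`; the maximum over the empty range
(`b < a`) is `0` by convention. -/
def maxOn (a b : ℕ) (f : ℕ → ℝ) : ℝ :=
  if h : (Finset.Icc a b).Nonempty then (Finset.Icc a b).sup' h f else 0

/-- `g` is a subgradient at the point `x` of the function `f : X → ℝ`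
(only the values of `f` on the domain `X ⊆ ℝ` matter). -/
def IsSubgradientOn (X : Set ℝ) (f : ℝ → ℝ) (x g : ℝ) : Prop :=
  ∀ y ∈ X, f x + g * (y - x) ≤ f y

/-! ### The algorithm -/

/-- The internal variables `(v_t, s_t, h_t)` of the learner at the beginning of a round. -/
structure State where
  v : ℝ
  s : ℝ
  h : ℝ

/-- The initialization `v₁ = s₁ = h₁ = 0`. -/
def State.init : State := ⟨0, 0, 0⟩

/-- The unprojected prediction `x̃_t`, computed from the internal variables. -/
def State.unprojected (ε : ℝ) (σ : State) : ℝ :=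
  if σ.h = 0 then 0
  else
    ε * erfi (σ.s / (2 * √(σ.v + 2 * σ.h * σ.s + 16 * σ.h ^ 2)))
      - ε * σ.h / √(σ.v + 2 * σ.h * σ.s + 16 * σ.h ^ 2)
        * Real.exp (σ.s ^ 2 / (4 * (σ.v + 2 * σ.h * σ.s + 16 * σ.h ^ 2)))

/-- The prediction `x_t`, i.e. the projection of `x̃_t` to `[0, ∞)`. -/
def State.predict (ε : ℝ) (σ : State) : ℝ := max (σ.unprojected ε) 0

/-- The clipped gradient: the projection of the gradient `g` to `[-lam * h_t, lam * h_t]`,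
with `lam` the discount factor received in the current round. -/
def State.clip (σ : State) (lam g : ℝ) : ℝ := max (-(lam * σ.h)) (min g (lam * σ.h))

/-- The surrogate loss gradient: `0` if `g_clip * x̃_t < g_clip * x_t`, and `g_clip` otherwise. -/
def State.surrogate (ε : ℝ) (σ : State) (lam g : ℝ) : ℝ :=
  if σ.clip lam g * σ.unprojected ε < σ.clip lam g * σ.predict ε then 0 else σ.clip lam g

/-- The update of the internal variables at the end of a round in which the gradient `g` and the
discount factor `lam` are received. -/
def State.step (ε : ℝ) (σ : State) (lam g : ℝ) : State where
  v := lam ^ 2 * σ.v + σ.surrogate ε lam g ^ 2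
  s := lam * σ.s - σ.surrogate ε lam g
  h := max (lam * σ.h) |g|

/-- The internal variables after `n` rounds (hence at the beginning of round `n + 1`). In round
`n + 1` the learner receives the gradient `g (n + 1)` and the discount factor `lam n`. -/
def stateAfter (ε : ℝ) (lam g : ℕ → ℝ) : ℕ → State
  | 0 => State.init
  | n + 1 => (stateAfter ε lam g n).step ε (lam n) (g (n + 1))

/-- The prediction `x_t` of the learner in round `t ≥ 1`. It only depends on
`g 1, …, g (t - 1)` and `lam 0, …, lam (t - 2)`. -/
def prediction (ε : ℝ) (lam g : ℕ → ℝ) (t : ℕ) : ℝ :=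
  (stateAfter ε lam g (t - 1)).predict ε

/-! ### The quantities in the regret bound -/

/-- The discounted regret `∑_{t=1}^T (∏_{i=t}^{T-1} λ_i) (l_t(x_t) - l_t(u))`. -/
def discountedRegret (lam : ℕ → ℝ) (l : ℕ → ℝ → ℝ) (x : ℕ → ℝ) (T : ℕ) (u : ℝ) : ℝ :=
  ∑ t ∈ Finset.Icc 1 T, (∏ i ∈ Finset.Ico t T, lam i) * (l t (x t) - l t u)

/-- The discounted gradient variance `V_t = ∑_{i=1}^t (∏_{j=i}^{t-1} λ_j²) g_i²`. -/
def gradVariance (lam g : ℕ → ℝ) (t : ℕ) : ℝ :=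
  ∑ i ∈ Finset.Icc 1 t, (∏ j ∈ Finset.Ico i t, lam j ^ 2) * g i ^ 2

/-- The discounted Lipschitz constant `G_t = max_{1 ≤ i ≤ t} (∏_{j=i}^{t-1} λ_j) |g_i|`
(with `G_0 = 0`). -/
def lipschitzConst (lam g : ℕ → ℝ) (t : ℕ) : ℝ :=
  maxOn 1 t fun i => (∏ j ∈ Finset.Ico i t, lam j) * |g i|

/-- The quantity
`S = 8 G (1 + √(log (2u/ε + 1)))² + 2 √(V + 16 G²) (1 + √(log (2u/ε + 1)))`. -/
def boundS (ε V G u : ℝ) : ℝ :=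
  8 * G * (1 + √(Real.log (2 * u / ε + 1))) ^ 2
    + 2 * √(V + 16 * G ^ 2) * (1 + √(Real.log (2 * u / ε + 1)))

end

end MagnitudeLearner

/-!
The proof is a potential argument. The learner predicts with the slope in `s` of
`Φ_h(v, s) = ε ψ(v + 2 h s + 16 h², s)`, where
`ψ(W, s) = s erfi (s / (2 √W)) - √W exp (s² / (4 W))` solves the backward heat equation
`∂_W ψ = -∂_s² ψ`. Along the curve `c ↦ (v + c², s + c)` the argument `W` has derivative `2 (h + c)`,
so at `c = 0` the velocity of the potential is exactly the prediction, and for `|c| ≤ h` its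
acceleration is a positive multiple of `y² - 2 y - 1 + 2 (h + c)² / W` with `y = (h + c) s / W`,
which is negative because `W ≥ 14 h²` and `-1/7 ≤ y ≤ 1`. The potential is therefore concave along
the curve and lies below its tangent (`heatPotential_step_le`). As the potential is homogeneous under
discounting (`heatPotential_scale`) and decreasing in `h` (`heatPotential_le_of_le`), each round
gives `Φ_{t+1} ≤ λ Φ_t - g̃ x̃` (`State.potential_step_le`). The surrogate gradients keep `s ≥ -h`,
which is what makes `W` positive.

Summing up, the surrogate regret against `u` is at most `u s - Φ(s)`, and it remains to bound the
conjugate of `Φ` (`conjugate_le`): for `s ≤ S` one uses `Φ ≥ -ε √W`, and beyond `S` the slope of `Φ`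
is at least `u`, by the lower bound `1 / (2 z)` for Dawson's function at `z = s / (2 √W)`.

Finally the clipping error of a gradient is the increase of the discounted Lipschitz parameter, so
that these errors telescope; weighted by the predictions they are summed separately before and after
the start of the window (`discountedSum_increment_le`).
-/

namespace MagnitudeLearner

/-! ### The function `erfi` -/

lemma hasDerivAt_erfi (x : ℝ) : HasDerivAt erfi (Real.exp (x ^ 2)) x :=
  (Continuous.integral_hasStrictDerivAt (f := fun u : ℝ => Real.exp (u ^ 2))
    (by fun_prop) 0 x).hasDerivAt

@[simp]
lemma erfi_zero : erfi 0 = 0 := by simp [erfi]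

lemma erfi_neg (x : ℝ) : erfi (-x) = -erfi x := by
  have h := intervalIntegral.integral_comp_neg (a := 0) (b := x)
    (fun u : ℝ => Real.exp (u ^ 2))
  simp only [even_two.neg_pow, neg_zero] at h
  rw [erfi, erfi, intervalIntegral.integral_symm, h]

lemma erfi_mono : Monotone erfi :=
  monotone_of_deriv_nonneg (fun x => (hasDerivAt_erfi x).differentiableAt) fun x => by
    rw [(hasDerivAt_erfi x).deriv]; positivity

lemma erfi_nonneg {x : ℝ} (hx : 0 ≤ x) : 0 ≤ erfi x := by
  simpa using erfi_mono hx

lemma erfi_nonpos {x : ℝ} (hx : x ≤ 0) : erfi x ≤ 0 := by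
  simpa using erfi_mono hx

/-- Both sides are even in `z`, and their difference has derivative `2 * erfi z`, so that it is
smallest at `z = 0`. -/
lemma exp_sq_sub_one_le (z : ℝ) : Real.exp (z ^ 2) - 1 ≤ 2 * z * erfi z := by
  have key : ∀ z : ℝ, 0 ≤ z → Real.exp (z ^ 2) - 1 ≤ 2 * z * erfi z := by
    intro z hz
    have hd (x : ℝ) : HasDerivAt (fun x => 2 * x * erfi x - Real.exp (x ^ 2)) (2 * erfi x) x := by
      have h1 := (((hasDerivAt_id x).const_mul 2).mul (hasDerivAt_erfi x)).sub
        ((hasDerivAt_id x).pow 2).exp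
      refine h1.congr_deriv ?_
      simp
      ring
    have hm : MonotoneOn (fun x => 2 * x * erfi x - Real.exp (x ^ 2)) (Set.Ici 0) := by
      refine monotoneOn_of_hasDerivWithinAt_nonneg (f' := fun x => 2 * erfi x) (convex_Ici 0)
        (fun x _ => (hd x).continuousAt.continuousWithinAt)
        (fun x _ => (hd x).hasDerivWithinAt) fun x hx => ?_
      have := erfi_nonneg (interior_subset hx : x ∈ Set.Ici (0 : ℝ))
      positivity
    have := hm (Set.self_mem_Ici) hz hz
    simp at this
    linarith
  rcases le_total 0 z with hz | hz
  · exact key z hz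
  · have := key (-z) (by linarith)
    rw [erfi_neg, neg_sq] at this
    linarith

lemma exp_one_le_two_mul_erfi_one : Real.exp 1 ≤ 2 * erfi 1 := by
  have h : ∫ u in (0 : ℝ)..1, (1 + u ^ 2 + u ^ 4 / 2) ≤ erfi 1 := by
    refine intervalIntegral.integral_mono_on zero_le_one
      (Continuous.intervalIntegrable (by fun_prop) _ _)
      (Continuous.intervalIntegrable (by fun_prop) _ _) fun u _ => ?_
    have := Real.quadratic_le_exp_of_nonneg (sq_nonneg u)
    nlinarith
  have h2 : ∫ u in (0 : ℝ)..1, (1 + u ^ 2 + u ^ 4 / 2) = 1 + 1 / 3 + 1 / 10 := by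
    rw [intervalIntegral.integral_add, intervalIntegral.integral_add]
    · simp; norm_num
    all_goals exact Continuous.intervalIntegrable (by fun_prop) _ _
  have := Real.exp_one_lt_d9
  linarith

/-- The classical lower bound `1 / (2 * z)` for Dawson's function `exp (-z ^ 2) * erfi z`. -/
lemma exp_sq_div_le_erfi {z : ℝ} (hz : 1 ≤ z) : Real.exp (z ^ 2) / (2 * z) ≤ erfi z := by
  have hd (x : ℝ) (hx : x ≠ 0) : HasDerivAt (fun x => erfi x - Real.exp (x ^ 2) / (2 * x))
      (Real.exp (x ^ 2) / (2 * x ^ 2)) x := by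
    have h1 := (hasDerivAt_erfi x).sub
      (((hasDerivAt_id x).pow 2).exp.div ((hasDerivAt_id x).const_mul 2) (by simpa using hx))
    refine h1.congr_deriv ?_
    simp
    field_simp
    ring
  have hne : ∀ x ∈ Set.Ici (1 : ℝ), x ≠ 0 := fun x hx => by
    have : (1 : ℝ) ≤ x := hx
    positivity
  have hm : MonotoneOn (fun x => erfi x - Real.exp (x ^ 2) / (2 * x)) (Set.Ici 1) :=
    monotoneOn_of_hasDerivWithinAt_nonneg (convex_Ici 1)
      (fun x hx => (hd x (hne x hx)).continuousAt.continuousWithinAt)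
      (fun x hx => (hd x (hne x (interior_subset hx))).hasDerivWithinAt)
      fun x _ => by positivity
  have := hm (Set.self_mem_Ici) hz hz
  have h1 := exp_one_le_two_mul_erfi_one
  simp at this
  linarith

/-- The growth of the prediction in its argument `z`: half of the lower bound for `erfi` pays for
the negative term, the other half dominates `exp ((z - 1) ^ 2) / 2`. -/
lemma le_erfi_sub {z q : ℝ} (hq : 0 ≤ q) (hz : 1 + q ≤ z) :
    (Real.exp (q ^ 2) - 1) / 2 ≤ erfi z - Real.exp (z ^ 2) / (4 * z) := by
  have hz1 : 1 ≤ z := by linarith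
  have h1 := exp_sq_div_le_erfi hz1
  have h2 : Real.exp (q ^ 2) ≤ Real.exp ((z - 1) ^ 2) := Real.exp_le_exp.2 (by gcongr; linarith)
  have h3 : Real.exp ((z - 1) ^ 2) ≤ Real.exp (z ^ 2) / (2 * z) := by
    rw [le_div_iff₀ (by positivity)]
    calc Real.exp ((z - 1) ^ 2) * (2 * z)
        ≤ Real.exp ((z - 1) ^ 2) * Real.exp (2 * z - 1) := by
          gcongr
          linarith [Real.add_one_le_exp (2 * z - 1)]
      _ = Real.exp (z ^ 2) := by rw [← Real.exp_add]; ring_nf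
  have h4 : Real.exp (z ^ 2) / (2 * z) = 2 * (Real.exp (z ^ 2) / (4 * z)) := by
    field_simp; norm_num
  linarith

/-! ### The backward heat potential -/

/-- The function `(W, s) ↦ s * erfi (s / (2 √W)) - √W * exp (s² / (4 W))`, a solution of the
backward heat equation `∂_W ψ = -∂_s² ψ` on `W > 0`. At `W = 0` junk division gives `0`, which is
the right value for the initial state, where `s = 0`. -/
noncomputable def heatPotential (W s : ℝ) : ℝ :=
  s * erfi (s / (2 * √W)) - √W * Real.exp (s ^ 2 / (4 * W))

/-- The common value `exp (s² / (4 W)) / (2 √W)` of `∂_s² ψ` and `-∂_W ψ` for the heat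
potential `ψ`. -/
noncomputable def heatKernel (W s : ℝ) : ℝ :=
  Real.exp (s ^ 2 / (4 * W)) / (2 * √W)

lemma heatKernel_pos {W : ℝ} (hW : 0 < W) (s : ℝ) : 0 < heatKernel W s := by
  unfold heatKernel; positivity

lemma sq_div_two_mul_sqrt {W : ℝ} (hW : 0 ≤ W) (s : ℝ) :
    (s / (2 * √W)) ^ 2 = s ^ 2 / (4 * W) := by
  rw [div_pow, mul_pow, Real.sq_sqrt hW]; norm_num

section Derivatives

variable {W S : ℝ → ℝ} {W' S' c : ℝ}

lemma hasDerivAt_erfi_comp (hW : HasDerivAt W W' c) (hS : HasDerivAt S S' c) (h0 : 0 < W c) :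
    HasDerivAt (fun c => erfi (S c / (2 * √(W c))))
      (heatKernel (W c) (S c) * (S' - S c * W' / (2 * W c))) c := by
  have hr : 0 < √(W c) := Real.sqrt_pos.2 h0
  have h1 := (hasDerivAt_erfi _).comp c
    (hS.div ((hW.sqrt h0.ne').const_mul 2) (by positivity))
  refine h1.congr_deriv ?_
  simp only [Pi.div_apply, sq_div_two_mul_sqrt h0.le, heatKernel]
  have h2 : W c = √(W c) ^ 2 := (Real.sq_sqrt h0.le).symm
  generalize Real.exp _ = e
  generalize √(W c) = r at *
  rw [h2]
  field_simp

lemma hasDerivAt_exp_comp (hW : HasDerivAt W W' c) (hS : HasDerivAt S S' c) (h0 : 0 < W c) :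
    HasDerivAt (fun c => Real.exp (S c ^ 2 / (4 * W c)))
      (Real.exp (S c ^ 2 / (4 * W c))
        * (S c * S' / (2 * W c) - S c ^ 2 * W' / (4 * W c ^ 2))) c := by
  have h1 := ((hS.pow 2).div (hW.const_mul 4) (by positivity)).exp
  refine h1.congr_deriv ?_
  simp
  field_simp
  ring

lemma hasDerivAt_heatPotential (hW : HasDerivAt W W' c) (hS : HasDerivAt S S' c)
    (h0 : 0 < W c) :
    HasDerivAt (fun c => heatPotential (W c) (S c))
      (erfi (S c / (2 * √(W c))) * S' - heatKernel (W c) (S c) * W') c := by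
  have hr : 0 < √(W c) := Real.sqrt_pos.2 h0
  have h1 := (hS.mul (hasDerivAt_erfi_comp hW hS h0)).sub
    ((hW.sqrt h0.ne').mul (hasDerivAt_exp_comp hW hS h0))
  refine h1.congr_deriv ?_
  simp only [heatKernel]
  have h2 : W c = √(W c) ^ 2 := (Real.sq_sqrt h0.le).symm
  generalize Real.exp _ = e
  generalize √(W c) = r at *
  rw [h2]
  field_simp
  ring

lemma hasDerivAt_heatKernel (hW : HasDerivAt W W' c) (hS : HasDerivAt S S' c) (h0 : 0 < W c) :
    HasDerivAt (fun c => heatKernel (W c) (S c))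
      (heatKernel (W c) (S c) * (S c * S' / (2 * W c)
        - (S c ^ 2 / (4 * W c ^ 2) + 1 / (2 * W c)) * W')) c := by
  have hr : 0 < √(W c) := Real.sqrt_pos.2 h0
  have h1 := (hasDerivAt_exp_comp hW hS h0).div ((hW.sqrt h0.ne').const_mul 2) (by positivity)
  refine h1.congr_deriv ?_
  simp only [heatKernel]
  have h2 : W c = √(W c) ^ 2 := (Real.sq_sqrt h0.le).symm
  generalize Real.exp _ = e
  generalize √(W c) = r at *
  rw [h2]
  field_simp
  ring

end Derivatives

lemma neg_sqrt_le_heatPotential {W : ℝ} (hW : 0 < W) (s : ℝ) : -√W ≤ heatPotential W s := by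
  have hr : 0 < √W := Real.sqrt_pos.2 hW
  have h := exp_sq_sub_one_le (s / (2 * √W))
  rw [sq_div_two_mul_sqrt hW.le, show 2 * (s / (2 * √W)) = s / √W by field_simp,
    div_mul_eq_mul_div, le_div_iff₀ hr] at h
  unfold heatPotential
  linarith

lemma heatPotential_antitoneOn (s : ℝ) :
    AntitoneOn (fun W => heatPotential W s) (Set.Ioi 0) := by
  have hd (W : ℝ) (hW : 0 < W) :=
    hasDerivAt_heatPotential (hasDerivAt_id W) (hasDerivAt_const W s) hW
  refine antitoneOn_of_deriv_nonpos (convex_Ioi 0)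
    (fun W hW => (hd W hW).continuousAt.continuousWithinAt)
    (fun W hW => (hd W (interior_subset hW)).differentiableAt.differentiableWithinAt)
    fun W hW => ?_
  have hW' : 0 < W := interior_subset hW
  have := heatKernel_pos hW' s
  have h1 := (hd W hW').deriv
  simp only [id_eq] at h1
  linarith

lemma heatPotential_scale {lam : ℝ} (hlam : 0 < lam) (W s : ℝ) :
    heatPotential (lam ^ 2 * W) (lam * s) = lam * heatPotential W s := by
  unfold heatPotential
  rw [Real.sqrt_mul (sq_nonneg _), Real.sqrt_sq hlam.le, mul_left_comm 2,
    mul_div_mul_left _ _ hlam.ne', mul_pow, mul_left_comm 4, mul_div_mul_left _ _ (by positivity)]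
  ring

/-- The graph of a function with nonpositive second derivative lies below its tangent lines. -/
lemma le_tangent_of_deriv2_nonpos {D : Set ℝ} (hD : Convex ℝ D) {f f' f'' : ℝ → ℝ}
    (hf : ∀ x ∈ D, HasDerivAt f (f' x) x) (hf' : ∀ x ∈ D, HasDerivAt f' (f'' x) x)
    (hf'' : ∀ x ∈ D, f'' x ≤ 0) {x y : ℝ} (hx : x ∈ D) (hy : y ∈ D) :
    f y ≤ f x + f' x * (y - x) := by
  have hc : ConcaveOn ℝ D f := concaveOn_of_hasDerivWithinAt2_nonpos hD
    (fun x hx => (hf x hx).continuousAt.continuousWithinAt)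
    (fun x hx => (hf x (interior_subset hx)).hasDerivWithinAt)
    (fun x hx => (hf' x (interior_subset hx)).hasDerivWithinAt)
    (fun x hx => hf'' x (interior_subset hx))
  rcases lt_trichotomy x y with h | rfl | h
  · have := hc.slope_le_of_hasDerivAt hx hy h (hf x hx)
    rw [slope_def_field, div_le_iff₀ (by linarith)] at this
    linarith
  · simp
  · have := hc.le_slope_of_hasDerivAt hy hx h (hf x hx)
    rw [slope_def_field, le_div_iff₀ (by linarith)] at this
    linarith

/-! ### The potential of the learner -/

/-- The variance proxy `W = v + 2 h s + 16 h²`. -/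
def totalVariance (v s h : ℝ) : ℝ := v + 2 * h * s + 16 * h ^ 2

/-- The derivative `∂_s` of `s ↦ ψ (v + 2 h s + 16 h², s)`; multiplied by `ε` it is the
unprojected prediction. -/
noncomputable def potentialSlope (v s h : ℝ) : ℝ :=
  erfi (s / (2 * √(totalVariance v s h))) - heatKernel (totalVariance v s h) s * (2 * h)

lemma le_totalVariance {v s h : ℝ} (hh : 0 ≤ h) (hv : 0 ≤ v) (hs : -h ≤ s) :
    14 * h ^ 2 ≤ totalVariance v s h := by
  unfold totalVariance
  nlinarith

lemma totalVariance_pos {v s h : ℝ} (hh : 0 < h) (hv : 0 ≤ v) (hs : -h ≤ s) :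
    0 < totalVariance v s h :=
  lt_of_lt_of_le (by positivity) (le_totalVariance hh.le hv hs)

/-- The algebraic core of the one-round inequality: up to a positive factor, the left-hand side
is the second derivative of the potential along `c ↦ (v + c², s + c)`. -/
lemma second_order_nonpos {v s h c : ℝ} (hh : 0 < h) (hv : 0 ≤ v) (hc : |c| ≤ h)
    (hs : -h ≤ s) :
    (h + c) ^ 2 * s ^ 2 / totalVariance v s h ^ 2 - 2 * ((h + c) * s / totalVariance v s h)
      - 1 + 2 * (h + c) ^ 2 / totalVariance v s h ≤ 0 := by
  have hW := totalVariance_pos hh hv hs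
  have hW14 := le_totalVariance hh.le hv hs
  obtain ⟨hc1, hc2⟩ := abs_le.1 hc
  set W := totalVariance v s h with hWdef
  have hsq : (h + c) ^ 2 ≤ (2 * h) ^ 2 := pow_le_pow_left₀ (by linarith) (by linarith) 2
  have h1 : 2 * (h + c) ^ 2 / W ≤ 4 / 7 := by
    rw [div_le_iff₀ hW]; nlinarith
  have h2 : (h + c) ^ 2 * s ^ 2 / W ^ 2 = ((h + c) * s / W) ^ 2 := by
    rw [div_pow, mul_pow]
  have h3 : (h + c) * s / W ≤ 1 := by
    rw [div_le_iff₀ hW, hWdef, totalVariance]; nlinarith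
  have h4 : -(1 / 7) ≤ (h + c) * s / W := by
    rw [le_div_iff₀ hW]; nlinarith
  rw [h2]
  nlinarith

/-- The one-round inequality (a discrete Itô formula): the potential is concave along the curve
`c ↦ (v + c², s + c)`, whose velocity at `c = 0` is `∂_s`. -/
lemma heatPotential_step_le {v s h c : ℝ} (hh : 0 < h) (hv : 0 ≤ v) (hs : -h ≤ s)
    (hc : |c| ≤ h) (hsc : -h ≤ s + c) :
    heatPotential (totalVariance (v + c ^ 2) (s + c) h) (s + c)
      ≤ heatPotential (totalVariance v s h) s + potentialSlope v s h * c := by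
  have hpos : ∀ b ∈ Set.Icc (-h) h ∩ Set.Ici (-h - s),
      0 < totalVariance (v + b ^ 2) (s + b) h := fun b hb =>
    totalVariance_pos hh (by positivity) (by have : -h - s ≤ b := hb.2; linarith)
  have hS (b : ℝ) : HasDerivAt (fun b => s + b) 1 b := (hasDerivAt_id b).const_add s
  have hW (b : ℝ) : HasDerivAt (fun b => totalVariance (v + b ^ 2) (s + b) h)
      (2 * (h + b)) b := by
    have := ((((hasDerivAt_id b).pow 2).const_add v).add ((hS b).const_mul (2 * h))).add_const
      (16 * h ^ 2)
    refine this.congr_deriv ?_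
    simp; ring
  have hB (b : ℝ) : HasDerivAt (fun b => 2 * (h + b)) 2 b := by
    simpa using ((hasDerivAt_id b).const_add h).const_mul 2
  have key := le_tangent_of_deriv2_nonpos
    ((convex_Icc (-h) h).inter (convex_Ici (-h - s)))
    (fun b hb => hasDerivAt_heatPotential (hW b) (hS b) (hpos b hb))
    (fun b hb => ((hasDerivAt_erfi_comp (hW b) (hS b) (hpos b hb)).mul_const 1).sub
      ((hasDerivAt_heatKernel (hW b) (hS b) (hpos b hb)).mul (hB b)))
    (fun b hb => by
      have hp := hpos b hb
      have h1 := second_order_nonpos (v := v + b ^ 2) (s := s + b) hh (by positivity)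
        (abs_le.2 hb.1) (by have : -h - s ≤ b := hb.2; linarith)
      have h2 := heatKernel_pos hp (s + b)
      generalize totalVariance (v + b ^ 2) (s + b) h = X at *
      generalize heatKernel X (s + b) = k at *
      refine le_of_eq_of_le ?_ (mul_nonpos_of_nonneg_of_nonpos h2.le h1)
      field_simp
      ring)
    (x := 0) (y := c) ⟨⟨by linarith, hh.le⟩, by simp; linarith⟩
    ⟨abs_le.1 hc, by simp; linarith⟩
  simpa [potentialSlope] using key

/-- A larger Lipschitz parameter `h` only decreases the potential. -/
lemma heatPotential_le_of_le {v s h h' : ℝ} (hh : 0 < h) (hv : 0 ≤ v) (hs : -h ≤ s)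
    (hle : h ≤ h') :
    heatPotential (totalVariance v s h') s ≤ heatPotential (totalVariance v s h) s := by
  refine heatPotential_antitoneOn s (totalVariance_pos hh hv hs)
    (totalVariance_pos (hh.trans_le hle) hv (by linarith)) ?_
  unfold totalVariance
  nlinarith

/-! ### The Fenchel conjugate of the potential -/

lemma boundS_nonneg {ε V G u : ℝ} (hG : 0 ≤ G) : 0 ≤ boundS ε V G u := by
  unfold boundS; positivity

lemma boundS_mono {ε u v h V G : ℝ} (hh : 0 ≤ h) (hv : v ≤ V) (hG : h ≤ G) :
    boundS ε v h u ≤ boundS ε V G u := by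
  unfold boundS; gcongr

/-- `boundS` dominates the larger root of `s² = 4 p² (v + 2 h s + 16 h²)`, where `p = 1 + √log`. -/
lemma le_arg_of_boundS_le {ε u v s h : ℝ} (hh : 0 < h) (hv : 0 ≤ v) (hs : boundS ε v h u ≤ s) :
    1 + √(Real.log (2 * u / ε + 1)) ≤ s / (2 * √(totalVariance v s h)) := by
  have hs0 : 0 ≤ s := (boundS_nonneg hh.le).trans hs
  have hW : 0 < totalVariance v s h := totalVariance_pos hh hv (by linarith)
  unfold boundS at hs
  set p := 1 + √(Real.log (2 * u / ε + 1)) with hp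
  have hp0 : 0 < p := by positivity
  set r := √(v + 16 * h ^ 2) with hr
  have hr2 : r ^ 2 = v + 16 * h ^ 2 := Real.sq_sqrt (by positivity)
  have hr0 : 0 ≤ r := Real.sqrt_nonneg _
  have hsq : √(totalVariance v s h) ≤ s / (2 * p) := by
    apply Real.sqrt_le_iff.2 ⟨by positivity, ?_⟩
    rw [div_pow, le_div_iff₀ (by positivity)]
    have h1 : 0 ≤ s - 8 * h * p ^ 2 - 2 * r * p := by linarith
    have h2 : totalVariance v s h = r ^ 2 + 2 * h * s := by
      rw [hr2, totalVariance]; ring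
    have h4 : 2 * r * p ≤ s - 8 * h * p ^ 2 := by linarith
    have h5 : 2 * r * p ≤ s := by nlinarith [mul_pos hh (pow_pos hp0 2)]
    have h6 : (2 * r * p) * (2 * r * p) ≤ s * (s - 8 * h * p ^ 2) :=
      mul_le_mul h5 h4 (by positivity) hs0
    rw [h2]
    nlinarith
  rw [le_div_iff₀ (by positivity)]
  rw [le_div_iff₀ (by positivity)] at hsq
  linarith

/-- Beyond `boundS` the slope of the potential is at least the comparator. -/
lemma le_potentialSlope {ε u v s h : ℝ} (hε : 0 < ε) (hu : 0 ≤ u) (hh : 0 < h) (hv : 0 ≤ v)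
    (hs : boundS ε v h u ≤ s) : u ≤ ε * potentialSlope v s h := by
  have hs0 : 0 ≤ s := (boundS_nonneg hh.le).trans hs
  have hW : 0 < totalVariance v s h := totalVariance_pos hh hv (by linarith)
  have hz := le_arg_of_boundS_le hh hv hs
  have hlog : 0 ≤ Real.log (2 * u / ε + 1) := Real.log_nonneg (by
    have : 0 ≤ 2 * u / ε := by positivity
    linarith)
  have h1 := le_erfi_sub (Real.sqrt_nonneg _) hz
  rw [Real.sq_sqrt hlog, Real.exp_log (by positivity)] at h1
  have hz0 : 0 < s / (2 * √(totalVariance v s h)) := lt_of_lt_of_le (by positivity) hz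
  have hr : 0 < √(totalVariance v s h) := Real.sqrt_pos.2 hW
  have hs1 : 0 < s := by
    by_contra hcon
    have : s = 0 := by linarith
    simp [this] at hz0
  -- `2 h s ≤ W` bounds the negative term `exp (z²) h / √W` by `exp (z²) / (4 z)`.
  have h2 : heatKernel (totalVariance v s h) s * (2 * h)
      ≤ Real.exp ((s / (2 * √(totalVariance v s h))) ^ 2)
        / (4 * (s / (2 * √(totalVariance v s h)))) := by
    rw [sq_div_two_mul_sqrt hW.le, heatKernel, div_mul_eq_mul_div, mul_div_assoc,
      div_eq_mul_inv _ (4 * _)]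
    refine mul_le_mul_of_nonneg_left ?_ (Real.exp_pos _).le
    rw [div_le_iff₀ (by positivity)]
    have h3 : 2 * h * s ≤ √(totalVariance v s h) * √(totalVariance v s h) := by
      rw [Real.mul_self_sqrt hW.le, totalVariance]; nlinarith
    generalize √(totalVariance v s h) = r at *
    have : (4 * (s / (2 * r)))⁻¹ * (2 * r) = r * r / s := by field_simp; norm_num
    rw [this, le_div_iff₀ hs1]
    exact h3
  have h3 : u / ε ≤ potentialSlope v s h := by
    unfold potentialSlope
    have : (2 * u / ε + 1 - 1) / 2 = u / ε := by ring
    linarith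
  rwa [div_le_iff₀' hε] at h3

lemma hasDerivAt_potential {v s h : ℝ} (hW : 0 < totalVariance v s h) :
    HasDerivAt (fun s => heatPotential (totalVariance v s h) s) (potentialSlope v s h) s := by
  have h1 : HasDerivAt (fun s => totalVariance v s h) (2 * h) s := by
    have := (((hasDerivAt_id s).const_mul (2 * h)).const_add v).add_const (16 * h ^ 2)
    exact this.congr_deriv (mul_one _)
  simpa [potentialSlope] using hasDerivAt_heatPotential h1 (hasDerivAt_id s) hW

/-- An upper bound for the Fenchel conjugate, in the variable `s`, of the potential at the
comparator `u`. -/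
lemma conjugate_le {ε u v s h : ℝ} (hε : 0 < ε) (hu : 0 ≤ u) (hh : 0 < h) (hv : 0 ≤ v)
    (hs : -h ≤ s) :
    u * s - ε * heatPotential (totalVariance v s h) s
      ≤ ε * √(totalVariance v (boundS ε v h u) h) + u * boundS ε v h u := by
  have hS := boundS_nonneg (ε := ε) (V := v) (u := u) hh.le
  rcases le_total s (boundS ε v h u) with hle | hle
  · have h1 := neg_sqrt_le_heatPotential (totalVariance_pos hh hv hs) s
    have h2 : √(totalVariance v s h) ≤ √(totalVariance v (boundS ε v h u) h) := by
      unfold totalVariance; gcongr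
    have h3 := mul_le_mul_of_nonneg_left hle hu
    nlinarith
  · have hpos : ∀ x ∈ Set.Ici (boundS ε v h u), 0 < totalVariance v x h := fun x hx =>
      totalVariance_pos hh hv (by have : boundS ε v h u ≤ x := hx; linarith)
    have hd : ∀ x ∈ Set.Ici (boundS ε v h u),
        HasDerivAt (fun s => ε * heatPotential (totalVariance v s h) s)
          (ε * potentialSlope v x h) x := fun x hx =>
      (hasDerivAt_potential (hpos x hx)).const_mul ε
    have h1 := (convex_Ici (boundS ε v h u)).mul_sub_le_image_sub_of_le_deriv
      (fun x hx => (hd x hx).continuousAt.continuousWithinAt)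
      (fun x hx => (hd x (interior_subset hx)).differentiableAt.differentiableWithinAt)
      (C := u)
      (fun x hx => by
        rw [(hd x (interior_subset hx)).deriv]
        exact le_potentialSlope hε hu hh hv (interior_subset hx))
      _ Set.self_mem_Ici s hle hle
    have h2 := neg_sqrt_le_heatPotential (hpos _ Set.self_mem_Ici) (boundS ε v h u)
    nlinarith

/-! ### The state of the learner -/

namespace State

variable {ε lam g : ℝ} {σ : State}

/-- The potential of a state; it is `0` for the initial state. -/
noncomputable def potential (ε : ℝ) (σ : State) : ℝ :=
  ε * heatPotential (totalVariance σ.v σ.s σ.h) σ.s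

/-- The invariant that keeps `v + 2 h s + 16 h²` nonnegative, and positive once `h ≠ 0`. -/
structure Valid (σ : State) : Prop where
  v_nonneg : 0 ≤ σ.v
  h_nonneg : 0 ≤ σ.h
  neg_h_le_s : -σ.h ≤ σ.s
  v_eq_zero : σ.h = 0 → σ.v = 0
  s_eq_zero : σ.h = 0 → σ.s = 0

lemma valid_init : State.init.Valid := by
  constructor <;> simp [State.init]

lemma predict_nonneg : 0 ≤ σ.predict ε := le_max_right _ _

lemma unprojected_eq (hh : σ.h ≠ 0) : σ.unprojected ε = ε * potentialSlope σ.v σ.s σ.h := by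
  rw [unprojected, if_neg hh, potentialSlope, heatKernel, totalVariance]
  ring

lemma unprojected_neg (hε : 0 < ε) (hσ : σ.Valid) (hh : 0 < σ.h) (hs : σ.s ≤ 0) :
    σ.unprojected ε < 0 := by
  rw [unprojected_eq hh.ne', potentialSlope]
  have hW := totalVariance_pos hh hσ.v_nonneg hσ.neg_h_le_s
  have h1 := heatKernel_pos hW σ.s
  have h2 : erfi (σ.s / (2 * √(totalVariance σ.v σ.s σ.h))) ≤ 0 :=
    erfi_nonpos (div_nonpos_of_nonpos_of_nonneg hs (by positivity))
  exact mul_neg_of_pos_of_neg hε (by nlinarith [mul_pos h1 hh])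

lemma abs_clip_le (h : 0 ≤ lam * σ.h) : |σ.clip lam g| ≤ lam * σ.h := by
  rw [abs_le, clip]
  exact ⟨le_max_left _ _, max_le (by linarith) (min_le_right _ _)⟩

lemma abs_clip_le_abs (h : 0 ≤ lam * σ.h) : |σ.clip lam g| ≤ |g| := by
  rw [abs_le, clip]
  have := neg_abs_le g
  have := le_abs_self g
  refine ⟨?_, max_le (by linarith [abs_nonneg g]) ((min_le_left _ _).trans this)⟩
  rcases le_total g (lam * σ.h) with h1 | h1
  · rw [min_eq_left h1]; exact le_max_of_le_right (by linarith)
  · rw [min_eq_right h1]; exact le_max_of_le_right (by linarith [abs_nonneg g])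

/-- The clipping error of a gradient is the increase of the Lipschitz parameter. -/
lemma abs_sub_clip_le : |g - σ.clip lam g| ≤ max (lam * σ.h) |g| - lam * σ.h := by
  have h1 := le_max_left (lam * σ.h) |g|
  have h2 := le_max_right (lam * σ.h) |g|
  have h3 := neg_abs_le g
  have h4 := le_abs_self g
  generalize max (lam * σ.h) |g| = m at *
  rw [clip, abs_le]
  rcases le_total g (lam * σ.h) with h | h
  · rw [min_eq_left h]
    rcases le_total (-(lam * σ.h)) g with h' | h'
    · rw [max_eq_right h']; constructor <;> linarith
    · rw [max_eq_left h']; constructor <;> linarith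
  · rw [min_eq_right h]
    rcases le_total (-(lam * σ.h)) (lam * σ.h) with h' | h'
    · rw [max_eq_right h']; constructor <;> linarith
    · rw [max_eq_left h']; constructor <;> linarith

lemma surrogate_eq_or : σ.surrogate ε lam g = 0 ∨ σ.surrogate ε lam g = σ.clip lam g := by
  unfold surrogate; split_ifs <;> simp

lemma abs_surrogate_le_abs_clip : |σ.surrogate ε lam g| ≤ |σ.clip lam g| := by
  rcases σ.surrogate_eq_or (ε := ε) (lam := lam) (g := g) with h | h <;> rw [h]
  simp

/-- Replacing clipped gradients by surrogate gradients and predictions by unprojected predictions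
does not decrease the linearized regret. -/
lemma clip_mul_le {u : ℝ} (hu : 0 ≤ u) :
    σ.clip lam g * (σ.predict ε - u) ≤ σ.surrogate ε lam g * (σ.unprojected ε - u) := by
  unfold surrogate
  split_ifs with h
  · have hlt : σ.unprojected ε < 0 := by
      by_contra hcon
      rw [predict, max_eq_left (not_lt.1 hcon)] at h
      exact lt_irrefl _ h
    rw [predict, max_eq_right hlt.le] at h ⊢
    have : 0 < σ.clip lam g := by
      rw [mul_zero] at h
      exact pos_of_mul_neg_left h hlt.le
    nlinarith
  · nlinarith

/-- For a negative unprojected prediction the surrogate gradient is nonpositive, so that `s` is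
not pushed further below `0`. -/
lemma neg_le_mul_sub_surrogate (hε : 0 < ε) (hσ : σ.Valid) (hlam : 0 < lam) :
    -(lam * σ.h) ≤ lam * σ.s - σ.surrogate ε lam g := by
  have hlh : 0 ≤ lam * σ.h := mul_nonneg hlam.le hσ.h_nonneg
  have hls : -(lam * σ.h) ≤ lam * σ.s := by nlinarith [hσ.neg_h_le_s]
  have hclip := abs_le.1 (abs_clip_le (g := g) hlh)
  unfold surrogate
  split_ifs with h
  · linarith
  · rcases le_or_gt 0 σ.s with hs | hs
    · nlinarith
    · have hh : 0 < σ.h := by linarith [hσ.neg_h_le_s]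
      have hneg := unprojected_neg hε hσ hh hs.le
      rw [predict, max_eq_right hneg.le, mul_zero, not_lt] at h
      have : σ.clip lam g ≤ 0 := by
        by_contra hcon
        nlinarith
      linarith

lemma Valid.step (hε : 0 < ε) (hlam : 0 < lam) (hσ : σ.Valid) : (σ.step ε lam g).Valid := by
  have hlh : 0 ≤ lam * σ.h := mul_nonneg hlam.le hσ.h_nonneg
  have hmax := le_max_left (lam * σ.h) |g|
  have hs := neg_le_mul_sub_surrogate (g := g) hε hσ hlam
  have hzero : max (lam * σ.h) |g| = 0 → σ.h = 0 ∧ σ.surrogate ε lam g = 0 := by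
    intro h
    have h1 : lam * σ.h = 0 := by linarith
    refine ⟨by simpa [hlam.ne'] using h1, abs_eq_zero.1 (le_antisymm ?_ (abs_nonneg _))⟩
    exact (abs_surrogate_le_abs_clip.trans (abs_clip_le hlh)).trans h1.le
  refine ⟨?_, hlh.trans hmax, (neg_le_neg hmax).trans hs, fun h => ?_, fun h => ?_⟩
  · have := hσ.v_nonneg
    simp only [State.step]; positivity
  · simp only [State.step, (hzero h).2, hσ.v_eq_zero (hzero h).1]; simp
  · simp only [State.step, (hzero h).2, hσ.s_eq_zero (hzero h).1]; simp

/-- In one round the discounted potential decreases by at least the surrogate loss. -/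
lemma potential_step_le (hε : 0 < ε) (hlam : 0 < lam) (hσ : σ.Valid) :
    (σ.step ε lam g).potential ε
      ≤ lam * σ.potential ε - σ.surrogate ε lam g * σ.unprojected ε := by
  have hlh : 0 ≤ lam * σ.h := mul_nonneg hlam.le hσ.h_nonneg
  have hsur := (abs_surrogate_le_abs_clip (ε := ε)).trans (abs_clip_le (g := g) hlh)
  rcases hσ.h_nonneg.eq_or_lt with hh | hh
  · -- Before the first nonzero gradient everything vanishes, except for the new `h = |g|`.
    have hg : σ.surrogate ε lam g = 0 := by
      rw [← hh, mul_zero] at hsur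
      exact abs_eq_zero.1 (le_antisymm hsur (abs_nonneg _))
    simp only [potential, State.step, hg, hσ.s_eq_zero hh.symm, hσ.v_eq_zero hh.symm, ← hh]
    have h0 (W : ℝ) : heatPotential W 0 = -√W := by simp [heatPotential]
    have h1 : totalVariance 0 0 0 = 0 := by simp [totalVariance]
    simp only [mul_zero, sub_zero, zero_mul, h0, h1, Real.sqrt_zero, neg_zero]
    exact mul_nonpos_of_nonneg_of_nonpos hε.le (neg_nonpos.2 (Real.sqrt_nonneg _))
  · have hs := neg_le_mul_sub_surrogate (g := g) hε hσ hlam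
    rw [unprojected_eq hh.ne']
    unfold potential State.step
    simp only
    set gt := σ.surrogate ε lam g
    -- The one-round inequality is applied to the state before discounting.
    have h1 := heatPotential_step_le (c := -(gt / lam)) hh hσ.v_nonneg hσ.neg_h_le_s
      (by rw [abs_neg, abs_div, abs_of_pos hlam, div_le_iff₀ hlam]; linarith)
      (by
        have : lam * (-σ.h) ≤ lam * (σ.s + -(gt / lam)) := by
          have : lam * (σ.s + -(gt / lam)) = lam * σ.s - gt := by field_simp; ring
          linarith
        exact le_of_mul_le_mul_left this hlam)
    have h2 := heatPotential_le_of_le (v := lam ^ 2 * σ.v + gt ^ 2) (s := lam * σ.s - gt)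
      (mul_pos hlam hh) (by have := hσ.v_nonneg; positivity) hs (le_max_left (lam * σ.h) |g|)
    have h3 := heatPotential_scale hlam
      (totalVariance (σ.v + (-(gt / lam)) ^ 2) (σ.s + -(gt / lam)) σ.h) (σ.s + -(gt / lam))
    have h4 : lam ^ 2 * totalVariance (σ.v + (-(gt / lam)) ^ 2) (σ.s + -(gt / lam)) σ.h
        = totalVariance (lam ^ 2 * σ.v + gt ^ 2) (lam * σ.s - gt) (lam * σ.h) := by
      unfold totalVariance; field_simp; ring
    have h5 : lam * (σ.s + -(gt / lam)) = lam * σ.s - gt := by field_simp; ring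
    rw [h4, h5] at h3
    rw [h3] at h2
    calc _ ≤ ε * (lam * (heatPotential (totalVariance σ.v σ.s σ.h) σ.s
            + potentialSlope σ.v σ.s σ.h * -(gt / lam))) := by
          gcongr
          exact h2.trans (by gcongr)
      _ = _ := by field_simp; ring

/-- The bound of the conjugate, in terms of upper bounds for the parameters of the state. -/
lemma Valid.conjugate_le {u V G : ℝ} (hε : 0 < ε) (hu : 0 ≤ u) (hσ : σ.Valid) (hV : σ.v ≤ V)
    (hG : σ.h ≤ G) :
    u * σ.s - σ.potential ε
      ≤ ε * √(V + 2 * G * boundS ε V G u + 16 * G ^ 2) + u * boundS ε V G u := by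
  have hS := boundS_nonneg (ε := ε) (V := V) (u := u) (hσ.h_nonneg.trans hG)
  rcases hσ.h_nonneg.eq_or_lt with hh | hh
  · simp only [potential, hσ.s_eq_zero hh.symm, hσ.v_eq_zero hh.symm, ← hh]
    simp [heatPotential, totalVariance]
    positivity
  · refine (MagnitudeLearner.conjugate_le hε hu hh hσ.v_nonneg hσ.neg_h_le_s).trans ?_
    have h0 := hσ.h_nonneg
    have h1 := boundS_mono (ε := ε) (u := u) h0 hV hG
    have h2 := boundS_nonneg (ε := ε) (V := σ.v) (u := u) h0
    have h3 := h0.trans hG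
    unfold totalVariance
    gcongr

end State

/-! ### Discounted sums -/

/-- The discounted sum `∑_{t=1}^n (∏_{i=t}^{n-1} λ_i) a_t`. -/
def discountedSum (lam a : ℕ → ℝ) (n : ℕ) : ℝ :=
  ∑ t ∈ Finset.Icc 1 n, (∏ i ∈ Finset.Ico t n, lam i) * a t

@[simp]
lemma discountedSum_zero (lam a : ℕ → ℝ) : discountedSum lam a 0 = 0 := by simp [discountedSum]

lemma discountedSum_succ (lam a : ℕ → ℝ) (n : ℕ) :
    discountedSum lam a (n + 1) = lam n * discountedSum lam a n + a (n + 1) := by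
  rw [discountedSum, Finset.sum_Icc_succ_top (by lia), discountedSum, Finset.mul_sum]
  congr 1
  · refine Finset.sum_congr rfl fun t ht => ?_
    rw [Finset.prod_Ico_succ_top (Finset.mem_Icc.1 ht).2]
    ring
  · simp

lemma discountedSum_add (lam a b : ℕ → ℝ) (n : ℕ) :
    discountedSum lam (fun t => a t + b t) n = discountedSum lam a n + discountedSum lam b n := by
  simp [discountedSum, mul_add, Finset.sum_add_distrib]

lemma discountedSum_mono {lam a b : ℕ → ℝ} {n : ℕ} (hlam : ∀ i < n, 0 < lam i)
    (h : ∀ t ∈ Finset.Icc 1 n, a t ≤ b t) : discountedSum lam a n ≤ discountedSum lam b n := by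
  refine Finset.sum_le_sum fun t ht => mul_le_mul_of_nonneg_left (h t ht) ?_
  exact Finset.prod_nonneg fun i hi => (hlam i (Finset.mem_Ico.1 hi).2).le

/-- The discounted increments of `H` telescope; weights `x t ≤ M` on the rounds after `m` cost at
most `M * H n`. -/
lemma discountedSum_increment_le {lam H x : ℕ → ℝ} {M : ℝ} {m n : ℕ} (hmn : m ≤ n)
    (hlam : ∀ i < n, 0 < lam i) (hM : 0 ≤ M) (hH : ∀ i, i ≤ n → 0 ≤ H i)
    (hinc : ∀ i < n, lam i * H i ≤ H (i + 1)) (hx : ∀ t ∈ Finset.Icc (m + 1) n, x t ≤ M) :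
    discountedSum lam (fun t => (H t - lam (t - 1) * H (t - 1)) * x t) n
      ≤ (∏ i ∈ Finset.Ico m n, lam i)
          * discountedSum lam (fun t => (H t - lam (t - 1) * H (t - 1)) * x t) m + M * H n := by
  induction n, hmn using Nat.le_induction with
  | base => simpa using mul_nonneg hM (hH m le_rfl)
  | succ n hmn ih =>
    have ih' := ih (fun i hi => hlam i (by lia)) (fun i hi => hH i (by lia))
      (fun i hi => hinc i (by lia)) fun t ht => hx t (by
        rw [Finset.mem_Icc] at ht ⊢; lia)
    have h1 := mul_le_mul_of_nonneg_left ih' (hlam n (by lia)).le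
    have h2 := mul_le_mul_of_nonneg_left (hx (n + 1) (by rw [Finset.mem_Icc]; lia))
      (sub_nonneg.2 (hinc n (by lia)))
    rw [discountedSum_succ, Finset.prod_Ico_succ_top hmn]
    simp only [Nat.add_sub_cancel]
    linarith

lemma discountedSum_increment (lam H : ℕ → ℝ) (h0 : H 0 = 0) (n : ℕ) :
    discountedSum lam (fun t => H t - lam (t - 1) * H (t - 1)) n = H n := by
  induction n with
  | zero => simp [h0]
  | succ n ih => rw [discountedSum_succ, ih]; simp

lemma le_maxOn {a b t : ℕ} (f : ℕ → ℝ) (ht : t ∈ Finset.Icc a b) : f t ≤ maxOn a b f := by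
  rw [maxOn, dif_pos ⟨t, ht⟩]
  exact Finset.le_sup' f ht

lemma maxOn_nonneg {a b : ℕ} {f : ℕ → ℝ} (hf : ∀ t, 0 ≤ f t) : 0 ≤ maxOn a b f := by
  rw [maxOn]
  split_ifs with h
  · obtain ⟨t, ht⟩ := h
    exact (hf t).trans (Finset.le_sup' f ht)
  · exact le_rfl

lemma mul_lipschitzConst_le {lam : ℕ → ℝ} (g : ℕ → ℝ) {n : ℕ} :
    lam n * lipschitzConst lam g n ≤ lipschitzConst lam g (n + 1) := by
  by_cases hne : (Finset.Icc 1 n).Nonempty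
  · obtain ⟨t, ht, heq⟩ := Finset.exists_mem_eq_sup' hne
      fun i => (∏ j ∈ Finset.Ico i n, lam j) * |g i|
    have h1 : lam n * lipschitzConst lam g n = (∏ j ∈ Finset.Ico t (n + 1), lam j) * |g t| := by
      rw [lipschitzConst, maxOn, dif_pos hne, heq,
        Finset.prod_Ico_succ_top (Finset.mem_Icc.1 ht).2]
      ring
    rw [h1]
    exact le_maxOn (fun i => (∏ j ∈ Finset.Ico i (n + 1), lam j) * |g i|)
      (Finset.Icc_subset_Icc_right n.le_succ ht)
  · have hn : n = 0 := by
      by_contra hcon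
      exact hne (Finset.nonempty_Icc.2 (by lia))
    subst hn
    simp [lipschitzConst, maxOn]

lemma abs_le_lipschitzConst (lam g : ℕ → ℝ) (n : ℕ) :
    |g (n + 1)| ≤ lipschitzConst lam g (n + 1) := by
  have := le_maxOn (fun i => (∏ j ∈ Finset.Ico i (n + 1), lam j) * |g i|)
    (Finset.mem_Icc.2 ⟨by lia, le_rfl⟩ : n + 1 ∈ Finset.Icc 1 (n + 1))
  simpa [lipschitzConst] using this

lemma gradVariance_succ (lam g : ℕ → ℝ) (n : ℕ) :
    gradVariance lam g (n + 1) = lam n ^ 2 * gradVariance lam g n + g (n + 1) ^ 2 :=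
  discountedSum_succ (fun j => lam j ^ 2) (fun i => g i ^ 2) n

/-! ### The trajectory of the learner -/

section Trajectory

variable {ε : ℝ} {lam g : ℕ → ℝ} {n : ℕ}

lemma stateAfter_valid (hε : 0 < ε) (hlam : ∀ i < n, 0 < lam i) :
    (stateAfter ε lam g n).Valid := by
  induction n with
  | zero => exact State.valid_init
  | succ n ih => exact (ih fun i hi => hlam i (by lia)).step hε (hlam n (by lia))

lemma stateAfter_h_le (hlam : ∀ i < n, 0 < lam i) :
    (stateAfter ε lam g n).h ≤ lipschitzConst lam g n := by
  induction n with
  | zero => simp [stateAfter, State.init, lipschitzConst, maxOn]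
  | succ n ih =>
    refine max_le ?_ (abs_le_lipschitzConst lam g n)
    exact (mul_le_mul_of_nonneg_left (ih fun i hi => hlam i (by lia)) (hlam n (by lia)).le).trans
      (mul_lipschitzConst_le g)

lemma stateAfter_v_le (hε : 0 < ε) (hlam : ∀ i < n, 0 < lam i) :
    (stateAfter ε lam g n).v ≤ gradVariance lam g n := by
  induction n with
  | zero => simp [stateAfter, State.init, gradVariance]
  | succ n ih =>
    have hlam' : ∀ i < n, 0 < lam i := fun i hi => hlam i (by lia)
    rw [gradVariance_succ]
    simp only [stateAfter, State.step]
    refine add_le_add (mul_le_mul_of_nonneg_left (ih hlam') (sq_nonneg _)) (sq_le_sq.2 ?_)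
    exact State.abs_surrogate_le_abs_clip.trans
      (State.abs_clip_le_abs (mul_nonneg (hlam n (by lia)).le (stateAfter_valid hε hlam').h_nonneg))

/-- The discounted surrogate regret of the unprojected predictions is controlled by the potential
of the current state. -/
lemma surrogate_regret_le (hε : 0 < ε) (hlam : ∀ i < n, 0 < lam i) (u : ℝ) :
    discountedSum lam (fun t => (stateAfter ε lam g (t - 1)).surrogate ε (lam (t - 1)) (g t)
        * ((stateAfter ε lam g (t - 1)).unprojected ε - u)) n
      ≤ u * (stateAfter ε lam g n).s - (stateAfter ε lam g n).potential ε := by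
  induction n with
  | zero => simp [stateAfter, State.init, State.potential, heatPotential, totalVariance]
  | succ n ih =>
    have hlam' : ∀ i < n, 0 < lam i := fun i hi => hlam i (by lia)
    have hn := hlam n (by lia)
    have h1 := State.potential_step_le (g := g (n + 1)) hε hn
      (stateAfter_valid (g := g) hε hlam')
    have h2 := mul_le_mul_of_nonneg_left (ih hlam') hn.le
    have h3 : (stateAfter ε lam g (n + 1)).s = lam n * (stateAfter ε lam g n).s
      - (stateAfter ε lam g n).surrogate ε (lam n) (g (n + 1)) := rfl
    rw [discountedSum_succ, h3]
    simp only [Nat.add_sub_cancel]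
    rw [← stateAfter] at h1
    linarith

end Trajectory

end MagnitudeLearner
open MagnitudeLearner in
theorem theorem2
    (ε : ℝ) (hε : 0 < ε)
    (T : ℕ) (hT : 1 ≤ T)
    (lam : ℕ → ℝ) (hlam : ∀ i < T, 0 < lam i)
    (l : ℕ → ℝ → ℝ) (hl : ∀ t ∈ Finset.Icc 1 T, ConvexOn ℝ (Set.Ici 0) (l t))
    (g : ℕ → ℝ)
    (hg : ∀ t ∈ Finset.Icc 1 T,
      IsSubgradientOn (Set.Ici 0) (l t) (prediction ε lam g t) (g t))
    (u : ℝ) (hu : 0 ≤ u)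
    (τ : ℕ) (hτ : τ ∈ Finset.Icc 1 T) :
    discountedRegret lam l (prediction ε lam g) T u
      ≤ ε * √(gradVariance lam g T
            + 2 * lipschitzConst lam g T
                * boundS ε (gradVariance lam g T) (lipschitzConst lam g T) u
            + 16 * lipschitzConst lam g T ^ 2)
        + u * (boundS ε (gradVariance lam g T) (lipschitzConst lam g T) u
            + lipschitzConst lam g T)
        + maxOn (T - τ + 1) T (prediction ε lam g) * lipschitzConst lam g T
        + (∏ t ∈ Finset.Ico (T - τ) T, lam t) * maxOn 1 (T - τ) (prediction ε lam g)
            * lipschitzConst lam g (T - τ) := by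
  set H : ℕ → ℝ := fun t => (stateAfter ε lam g t).h with hH
  have hlam' : ∀ {n}, n ≤ T → ∀ i < n, 0 < lam i := fun hn i hi => hlam i (by lia)
  have hH0 : ∀ i ≤ T, 0 ≤ H i := fun i hi => (stateAfter_valid hε (hlam' hi)).h_nonneg
  have hinc : ∀ i < T, lam i * H i ≤ H (i + 1) := fun i _ => le_max_left _ _
  have hx0 : ∀ t, 0 ≤ prediction ε lam g t := fun t => State.predict_nonneg
  have hM1 := maxOn_nonneg (a := 1) (b := T - τ) hx0
  have hM2 := maxOn_nonneg (a := T - τ + 1) (b := T) hx0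
  -- Each round costs at most its surrogate regret and its clipping error against `x` and `u`.
  have hround : ∀ t ∈ Finset.Icc 1 T, l t (prediction ε lam g t) - l t u
      ≤ (stateAfter ε lam g (t - 1)).surrogate ε (lam (t - 1)) (g t)
          * ((stateAfter ε lam g (t - 1)).unprojected ε - u)
        + ((H t - lam (t - 1) * H (t - 1)) * prediction ε lam g t
        + (H t - lam (t - 1) * H (t - 1)) * u) := by
    intro t ht
    have h1 := hg t ht u hu
    obtain ⟨n, rfl⟩ : ∃ n, t = n + 1 := ⟨t - 1, by rw [Finset.mem_Icc] at ht; lia⟩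
    have h2 := (stateAfter ε lam g n).clip_mul_le (ε := ε) (lam := lam n) (g := g (n + 1)) hu
    have h3 := abs_le.1
      ((stateAfter ε lam g n).abs_sub_clip_le (lam := lam n) (g := g (n + 1)))
    have h4 : H (n + 1) = max (lam n * H n) |g (n + 1)| := rfl
    have h5 : prediction ε lam g (n + 1) = (stateAfter ε lam g n).predict ε := rfl
    have h6 := hx0 (n + 1)
    simp only [Nat.add_sub_cancel]
    rw [h4]
    rw [← h5] at h2
    have h7 := mul_le_mul_of_nonneg_right h3.2 h6
    have h8 := mul_le_mul_of_nonneg_right h3.1 hu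
    linarith
  have hsum := discountedSum_mono hlam hround
  rw [discountedSum_add, discountedSum_add] at hsum
  have hsur := surrogate_regret_le (g := g) hε hlam u
  have hconj := (stateAfter_valid (g := g) hε hlam).conjugate_le hε hu (stateAfter_v_le hε hlam)
    (stateAfter_h_le hlam)
  have hclipu : discountedSum lam (fun t => (H t - lam (t - 1) * H (t - 1)) * u) T
      ≤ u * lipschitzConst lam g T := by
    have h1 : discountedSum lam (fun t => (H t - lam (t - 1) * H (t - 1)) * u) T = H T * u := by
      rw [← discountedSum_increment lam H rfl T, discountedSum, discountedSum, Finset.sum_mul]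
      simp only [mul_assoc]
    rw [h1, mul_comm]
    exact mul_le_mul_of_nonneg_left (stateAfter_h_le hlam) hu
  -- The clipping error against `x` is summed separately up to round `T - τ` and after it.
  have hm : T - τ ≤ T := Nat.sub_le _ _
  have hlate := discountedSum_increment_le hm hlam hM2 hH0 hinc
    fun t ht => le_maxOn (prediction ε lam g) ht
  have hearly := discountedSum_increment_le (Nat.zero_le (T - τ)) (hlam' hm) hM1
    (fun i hi => hH0 i (hi.trans hm)) (fun i hi => hinc i (hi.trans_le hm))
    fun t ht => le_maxOn (prediction ε lam g) (by simpa using ht)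
  rw [discountedSum_zero, mul_zero, zero_add] at hearly
  have hP : 0 ≤ ∏ i ∈ Finset.Ico (T - τ) T, lam i :=
    Finset.prod_nonneg fun i hi => (hlam i (Finset.mem_Ico.1 hi).2).le
  have h1 : (∏ i ∈ Finset.Ico (T - τ) T, lam i)
        * discountedSum lam (fun t => (H t - lam (t - 1) * H (t - 1)) * prediction ε lam g t)
          (T - τ)
      ≤ (∏ t ∈ Finset.Ico (T - τ) T, lam t) * maxOn 1 (T - τ) (prediction ε lam g)
          * lipschitzConst lam g (T - τ) := by
    rw [mul_assoc]
    exact mul_le_mul_of_nonneg_left (hearly.trans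
      (mul_le_mul_of_nonneg_left (stateAfter_h_le (hlam' hm)) hM1)) hP
  have h2 : maxOn (T - τ + 1) T (prediction ε lam g) * H T
      ≤ maxOn (T - τ + 1) T (prediction ε lam g) * lipschitzConst lam g T :=
    mul_le_mul_of_nonneg_left (stateAfter_h_le hlam) hM2
  have h3 : discountedRegret lam l (prediction ε lam g) T u
    = discountedSum lam (fun t => l t (prediction ε lam g t) - l t u) T := rfl
  rw [h3]
  linarith
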